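/- For a permutation $w=w_1\cdots w_n$ of $\{1,\dots,n\}$, an alternating subsequence of $w$ is a subsequence $w_{i_1},\dots,w_{i_k}$ ($i_1<\cdots<i_k$) with $w_{i_1}>w_{i_2}<w_{i_3}>w_{i_4}<\cdots$ (so that, if it has length at least two, it begins with a descent; every subsequence of length $0$ or $1$ is alternating). Let $\mathrm{as}(w)$ be the largest length of an alternating subsequence of $w$. For $n,k\ge 0$ let $a_k(n)$ be the number of permutations $w$ of $\{1,\dots,n\}$ with $\mathrm{as}(w)=k$, and let $T_n(t)=\sum_{k=0}^n a_k(n)t^k\in\mathbb{Z}[t]$. Let $E_n$ be the Euler number, i.e. the number of permutations $w$ of $\{1,\dots,n\}$ with $w_1>w_2<w_3>\cdots w_n$ (for odd $n$, $E_n$ is called a tangent number). Then for every $n\ge 0$ the polynomial $T_n(t)$ is divisible by $(1+t)^{\lfloor n/2\rfloor}$ in $\mathbb{Z}[t]$. Moreover, if $U_n(t)=T_n(t)/(1+t)^{\lfloor n/2\rfloor}$, then for every $n\ge 0$ $$U_{2n}(-1)=-U_{2n+1}(-1)=\frac{(-1)^nE_{2n+1}}{2^n}.$$ In particular, for every $n\ge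 2$ we have $T_n(-1)=0$, that is, $$\#\{w:\mathrm{as}(w)\text{ even}\}=\#\{w:\mathrm{as}(w)\text{ odd}\}=\frac{n!}{2},$$ where $w$ ranges over the permutations of $\{1,\dots,n\}$. -/

import Mathlib

open Polynomial

/-- A finite sequence `s 0, s 1, …` is alternating if `s 0 > s 1 < s 2 > s 3 < ⋯`:
with positions counted from `0`, it descends after each even position and ascends after each
odd one. Sequences of length `0` and `1` are alternating. -/
def IsAlternating {α : Type*} [LT α] {k : ℕ} (s : Fin k → α) : Prop :=
  ∀ i j : Fin k, (i : ℕ) + 1 = j →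
    (Even (i : ℕ) → s j < s i) ∧ (Odd (i : ℕ) → s i < s j)

instance {α : Type*} [LT α] [DecidableLT α] {k : ℕ} (s : Fin k → α) :
    Decidable (IsAlternating s) := by
  unfold IsAlternating
  infer_instance

/-- The lengths of the alternating subsequences `w (p 0), …, w (p (k - 1))`,
`p 0 < ⋯ < p (k - 1)`, of the permutation `w`. -/
def altSubseqLengths {n : ℕ} (w : Equiv.Perm (Fin n)) : Set ℕ :=
  {k | ∃ p : Fin k → Fin n, StrictMono p ∧ IsAlternating (fun i => w (p i))}

/-- `as(w)`: the length of the longest alternating subsequence of `w`. -/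
noncomputable def altLength {n : ℕ} (w : Equiv.Perm (Fin n)) : ℕ :=
  sSup (altSubseqLengths w)

/-- The supremum defining `altLength` is a maximum, so `altLength` has no default value. -/
theorem altLength_isGreatest {n : ℕ} (w : Equiv.Perm (Fin n)) :
    IsGreatest (altSubseqLengths w) (altLength w) := by
  have hb : BddAbove (altSubseqLengths w) := by
    refine ⟨n, ?_⟩
    rintro k ⟨p, hp, -⟩
    simpa using Fintype.card_le_of_injective p hp.injective
  have hne : (altSubseqLengths w).Nonempty :=
    ⟨0, fun i => i.elim0, fun i => i.elim0, fun i => i.elim0⟩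
  exact ⟨Nat.sSup_mem hne hb, fun k hk => le_csSup hb hk⟩

/-- `a_k(n)`: the number of permutations `w` of `n` letters with `as(w) = k`. -/
noncomputable def altCount (k n : ℕ) : ℕ :=
  (Finset.univ.filter fun w : Equiv.Perm (Fin n) => altLength w = k).card

/-- The polynomial `T_n(t) = ∑_{k=0}^n a_k(n) t^k`. -/
noncomputable def altPoly (n : ℕ) : ℤ[X] :=
  ∑ k ∈ Finset.range (n + 1), C (altCount k n : ℤ) * X ^ k

/-- The Euler number `E_n`: the number of alternating permutations `w_1 > w_2 < w_3 > ⋯` of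
`n` letters. For odd `n` it is called a tangent number. -/
def eulerNumber (n : ℕ) : ℕ :=
  (Finset.univ.filter fun w : Equiv.Perm (Fin n) => IsAlternating w).card

/-! For a word without repetitions, as(w) is the number of monotone runs of 0, w: an alternating
subsequence picks at most one entry per run, and run ends attain the bound. Of the n + 1 places for
a new maximum, as(w) = k of them keep as, one adds 1 and n - k add 2. This gives `altPoly_succ`, a
recurrence in which every second step produces a factor 1 + t.

For the value at -1, put t = (s² + 1)/(s² - 1) and homogenize: T_n becomes s^(n-1) P_n(s), where P_n
is the n-th derivative of tan as a polynomial in tan (`X_mul_altPolyHom`). At s = 1 only as(w) = n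
survives, so P_n(1) = 2^n E_n; at s = 0 one has t = -1. For odd n the tangent addition formula gives
P_n(1) = 2^n P_n(0), which links the two points. -/

/-! ### Longest alternating subsequences and monotone runs -/

section Turns

variable {α : Type*} [LinearOrder α]

/-- The number of changes of direction along the path `a, l₀, l₁, …` when the step into `a`
was upward (`up = true`) or downward (`up = false`). -/
def turns : Bool → α → List α → ℕ
  | _, _, [] => 0
  | up, a, b :: l => if decide (a < b) = up then turns up b l else turns (!up) b l + 1

/-- The number of up-down runs of a list, when it is preceded by a value below all its entries. -/
def upDownRuns : List α → ℕ
  | [] => 0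
  | a :: l => turns true a l + 1

/-- A list is alternating, its first step being upward if and only if `up = true`. -/
def AltList : Bool → List α → Prop
  | up, a :: b :: l => (if up then a < b else b < a) ∧ AltList (!up) (b :: l)
  | _, _ => True

theorem turns_le_length (up : Bool) (a : α) (l : List α) : turns up a l ≤ l.length := by
  induction l generalizing up a with
  | nil => simp [turns]
  | cons b l ih =>
    rw [turns, List.length_cons]
    split_ifs
    · exact (ih up b).trans (Nat.le_succ _)
    · exact Nat.succ_le_succ (ih _ b)

theorem upDownRuns_le_length (l : List α) : upDownRuns l ≤ l.length := by
  cases l with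
  | nil => simp [upDownRuns]
  | cons a l => simpa [upDownRuns] using turns_le_length true a l

theorem AltList.tail {up : Bool} {a : α} {s : List α} (h : AltList up (a :: s)) :
    AltList (!up) s := by
  cases s with
  | nil => simp [AltList]
  | cons b s => exact h.2

theorem AltList.replace_head {up : Bool} {a b : α} {s : List α} (h : AltList up (a :: s))
    (hab : if up then b ≤ a else a ≤ b) : AltList up (b :: s) := by
  cases s with
  | nil => simp [AltList]
  | cons c s =>
    refine ⟨?_, h.2⟩
    have h1 := h.1
    cases up
    · simp only [Bool.false_eq_true, if_false] at h1 hab ⊢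
      exact h1.trans_le hab
    · simp only [if_true] at h1 hab ⊢
      exact hab.trans_lt h1

/-- Alternating sublists whose first step opposes the current direction have at most one entry
more than there are turns. -/
theorem AltList.length_le_turns {up : Bool} {a : α} {l s : List α}
    (hs : s.Sublist (a :: l)) (h : AltList (!up) s) : s.length ≤ turns up a l + 1 := by
  induction l generalizing up a s with
  | nil => simpa [turns] using hs.length_le
  | cons b l ih =>
    rw [turns]
    split_ifs with hd
    · rcases List.sublist_cons_iff.1 hs with hs | ⟨r, rfl, hr⟩
      · exact ih hs h
      · rcases List.sublist_cons_iff.1 hr with hr | ⟨q, rfl, hq⟩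
        -- The path goes on from `a` to `b` in direction `up`, so `b` can replace `a` as the first
        -- entry.
        · have := ih (up := up) (a := b) (s := b :: r) (hr.cons_cons b)
            (h.replace_head (by cases up <;> simp_all [le_of_lt]))
          simpa using this
        · exfalso
          have := h.1
          cases up
          · exact absurd (show a < b by simpa using this) (by simpa using hd)
          · exact absurd (show b < a by simpa using this) (not_lt_of_gt (by simpa using hd))
    -- At a turn the first entry may be dropped: the extra turn pays for it.
    · rcases List.sublist_cons_iff.1 hs with hs | ⟨r, rfl, hr⟩
      · cases s with
        | nil => simp
        | cons c s =>
          have := ih (up := !up) (a := b) (s := s) ((List.sublist_cons_self c s).trans hs)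
            h.tail
          simpa using this
      · have := ih (up := !up) (a := b) (s := r) hr h.tail
        simpa using this

/-- The final bound on `c` strengthens the induction: it lets an earlier entry be prepended at a
turn. -/
theorem exists_altList_length_eq_turns (up : Bool) (a : α) (l : List α) (hl : (a :: l).Nodup) :
    ∃ (c : α) (s : List α), (c :: s).Sublist (a :: l) ∧ AltList (!up) (c :: s) ∧
      (c :: s).length = turns up a l + 1 ∧ (if up then a ≤ c else c ≤ a) := by
  induction l generalizing up a with
  | nil => exact ⟨a, [], by simp, by simp [AltList], by simp [turns], by simp⟩
  | cons b l ih =>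
    have hab : a ≠ b := by
      rintro rfl
      simp at hl
    have hl' : (b :: l).Nodup := (List.nodup_cons.1 hl).2
    by_cases hd : decide (a < b) = up
    · rw [turns, if_pos hd]
      obtain ⟨c, s, hs, h1, h2, h3⟩ := ih up b hl'
      refine ⟨c, s, hs.trans (List.sublist_cons_self _ _), h1, h2, ?_⟩
      cases up
      · simp only [decide_eq_false_iff_not, not_lt, Bool.false_eq_true, if_false] at hd h3 ⊢
        exact le_trans h3 hd
      · simp only [decide_eq_true_eq, if_true] at hd h3 ⊢
        exact le_trans hd.le h3
    · rw [turns, if_neg hd]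
      obtain ⟨c, s, hs, h1, h2, h3⟩ := ih (!up) b hl'
      refine ⟨a, c :: s, hs.cons_cons a, ⟨?_, h1⟩, by simpa using h2, by simp⟩
      cases up
      · simp only [decide_eq_false_iff_not, not_not, Bool.not_false, if_true] at hd h3 ⊢
        exact lt_of_lt_of_le hd h3
      · simp only [decide_eq_true_eq, not_lt, Bool.not_true, Bool.false_eq_true,
          if_false] at hd h3 ⊢
        exact h3.trans_lt (lt_of_le_of_ne hd hab.symm)

theorem isGreatest_upDownRuns {l : List α} (hl : l.Nodup) :
    IsGreatest {k | ∃ s : List α, s.Sublist l ∧ AltList false s ∧ s.length = k}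
      (upDownRuns l) := by
  cases l with
  | nil =>
    refine ⟨⟨[], by simp, by simp [AltList], rfl⟩, ?_⟩
    rintro k ⟨s, hs, -, rfl⟩
    simpa [upDownRuns] using hs.length_le
  | cons a l =>
    obtain ⟨c, s, hs, h1, h2, -⟩ := exists_altList_length_eq_turns true a l hl
    refine ⟨⟨c :: s, hs, h1, h2⟩, ?_⟩
    rintro k ⟨s, hs, h, rfl⟩
    exact AltList.length_le_turns (up := true) hs h

theorem altList_iff_getElem (up : Bool) (l : List α) :
    AltList up l ↔ ∀ i (h : i + 1 < l.length),
      if (i.bodd ^^ up) then l[i] < l[i + 1] else l[i + 1] < l[i] := by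
  induction l generalizing up with
  | nil => simp [AltList]
  | cons a l ih =>
    cases l with
    | nil => simp [AltList]
    | cons b l =>
      rw [AltList, ih]
      constructor
      · rintro ⟨h0, h⟩ i hi
        cases i with
        | zero => simpa using h0
        | succ i =>
          have := h i (by simpa using hi)
          simpa [Nat.bodd_succ] using this
      · intro h
        refine ⟨by simpa using h 0 (by simp), fun i hi => ?_⟩
        have := h (i + 1) (by simpa using hi)
        simpa [Nat.bodd_succ] using this

theorem isAlternating_iff_altList {k : ℕ} (s : Fin k → α) :
    IsAlternating s ↔ AltList false (List.ofFn s) := by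
  rw [altList_iff_getElem]
  constructor
  · intro h i hi
    have hi' : i + 1 < k := by simpa using hi
    have h1 := h ⟨i, by omega⟩ ⟨i + 1, hi'⟩ rfl
    rcases Nat.even_or_odd i with he | ho
    · have hb : i.bodd = false := by
        obtain ⟨r, rfl⟩ := he; simp
      simpa [hb] using h1.1 he
    · have hb : i.bodd = true := by
        obtain ⟨r, rfl⟩ := ho; simp [show Nat.bodd 2 = false from rfl]
      simpa [hb] using h1.2 ho
  · intro h i j hij
    obtain ⟨j, hj⟩ := j
    obtain ⟨i, hi⟩ := i
    simp only at hij
    subst hij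
    have h1 := h i (by simpa using hj)
    constructor
    · intro he
      have hb : i.bodd = false := by
        obtain ⟨r, rfl⟩ := (he : Even i); simp
      simpa [hb] using h1
    · intro ho
      have hb : i.bodd = true := by
        obtain ⟨r, rfl⟩ := (ho : Odd i); simp [show Nat.bodd 2 = false from rfl]
      simpa [hb] using h1

theorem altLength_eq_upDownRuns {n : ℕ} (w : Equiv.Perm (Fin n)) :
    altLength w = upDownRuns (List.ofFn w) := by
  have hl : (List.ofFn w).Nodup := List.nodup_ofFn.2 w.injective
  refine (altLength_isGreatest w).unique ?_
  suffices h : altSubseqLengths w =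
      {k | ∃ s : List (Fin n), s.Sublist (List.ofFn w) ∧ AltList false s ∧ s.length = k} from
    h ▸ isGreatest_upDownRuns hl
  ext k
  constructor
  · rintro ⟨p, hp, h⟩
    refine ⟨List.ofFn fun i => w (p i), ?_, (isAlternating_iff_altList _).1 h, by simp⟩
    rw [List.sublist_iff_exists_fin_orderEmbedding_get_eq]
    refine ⟨(Fin.castOrderIso (by simp)).toOrderEmbedding.trans
      ((OrderEmbedding.ofStrictMono p hp).trans
        (Fin.castOrderIso (by simp)).toOrderEmbedding), fun i => ?_⟩
    simp
    rfl
  · rintro ⟨s, hs, h, rfl⟩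
    obtain ⟨f, hf⟩ := List.sublist_iff_exists_fin_orderEmbedding_get_eq.1 hs
    refine ⟨fun i => Fin.cast (by simp) (f i), fun i j hij => ?_, ?_⟩
    · simpa using hij
    · have : (fun i => w (Fin.cast (by simp) (f i))) = s.get := by
        ext i
        rw [hf i]
        simp
        rfl
      rw [this, isAlternating_iff_altList, List.ofFn_get]
      exact h

end Turns

/-! ### Runs after insertion of a maximum -/

section Insertion

variable {α R : Type*} [LinearOrder α] [CommRing R]

/-- The sum of `g (turns up a l')` over all lists `l'` obtained from `l` by inserting an entry
above all others. The number of turns after a downward and after an upward step enter together. -/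
theorem sum_turns_insertIdx (l : List α) (a M : α) (ha : a < M) (hM : ∀ b ∈ l, b < M)
    (g : ℕ → R) :
    (∑ i ∈ Finset.range (l.length + 1), g (turns false a (l.insertIdx i M)) =
      turns false a l * g (turns false a l) + g (turns false a l + 1) +
        (l.length - turns false a l) * g (turns false a l + 2)) ∧
    (∑ i ∈ Finset.range (l.length + 1), g (turns true a (l.insertIdx i M)) =
      (turns true a l + 1) * g (turns true a l) + g (turns true a l + 1) +
        (l.length - turns true a l) * g (turns true a l + 2) - g (turns false a l + 1)) := by
  induction l generalizing a g with
  | nil => simp [turns, ha]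
  | cons b l ih =>
    have hb : b < M := hM b (by simp)
    have hl : ∀ c ∈ l, c < M := fun c hc => hM c (by simp [hc])
    simp only [List.length_cons]
    rw [Finset.sum_range_succ' (fun i => g (turns false a ((b :: l).insertIdx i M))),
      Finset.sum_range_succ' (fun i => g (turns true a ((b :: l).insertIdx i M)))]
    simp only [List.insertIdx_zero, List.insertIdx_succ_cons]
    -- After the step from `a` to `b` both claims rest on the same half of the induction hypothesis,
    -- used for `g` and for its shift.
    by_cases hab : a < b
    · have h := (ih b hb hl g).2
      have h' := (ih b hb hl fun k => g (k + 1)).2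
      simp only [turns, hab, ha, hb.not_gt, decide_true, decide_false, Bool.true_eq_false,
        if_true, if_false, Bool.not_false, Bool.not_true, Bool.false_eq_true] at h h' ⊢
      rw [h, h']
      push_cast
      constructor <;> ring_nf
    · have h := (ih b hb hl g).1
      have h' := (ih b hb hl fun k => g (k + 1)).1
      simp only [turns, hab, ha, hb.not_gt, decide_true, decide_false, Bool.true_eq_false,
        if_true, if_false, Bool.not_false, Bool.not_true, Bool.false_eq_true] at h h' ⊢
      rw [h, h']
      push_cast
      constructor <;> ring_nf

/-- Insertion in front of the whole list supplies exactly the term subtracted in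
`sum_turns_insertIdx`. -/
theorem sum_upDownRuns_insertIdx (l : List α) (M : α) (hM : ∀ b ∈ l, b < M) (g : ℕ → R) :
    ∑ i ∈ Finset.range (l.length + 1), g (upDownRuns (l.insertIdx i M)) =
      upDownRuns l * g (upDownRuns l) + g (upDownRuns l + 1) +
        (l.length - upDownRuns l) * g (upDownRuns l + 2) := by
  cases l with
  | nil => simp [upDownRuns, turns]
  | cons a l =>
    have ha : a < M := hM a (by simp)
    have h := (sum_turns_insertIdx l a M ha (fun c hc => hM c (by simp [hc]))
      fun k => g (k + 1)).2
    simp only [List.length_cons]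
    rw [Finset.sum_range_succ']
    simp only [List.insertIdx_zero, List.insertIdx_succ_cons, upDownRuns, turns, ha.not_gt,
      decide_false, Bool.false_eq_true, if_false, Bool.not_true] at h ⊢
    rw [h]
    push_cast
    ring_nf

theorem turns_map {β : Type*} [LinearOrder β] {f : α → β} (hf : StrictMono f) (up : Bool)
    (a : α) (l : List α) : turns up (f a) (l.map f) = turns up a l := by
  induction l generalizing up a with
  | nil => simp [turns]
  | cons b l ih => simp [turns, hf.lt_iff_lt, ih]

theorem upDownRuns_map {β : Type*} [LinearOrder β] {f : α → β} (hf : StrictMono f)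
    (l : List α) : upDownRuns (l.map f) = upDownRuns l := by
  cases l with
  | nil => simp [upDownRuns]
  | cons a l => simp [upDownRuns, turns_map hf]

end Insertion

/-! ### Insertion of the largest value into permutations -/

theorem ofFn_insertNth_eq_insertIdx {α : Type*} {n : ℕ} (i : Fin (n + 1)) (x : α) (f : Fin n → α) :
    List.ofFn (Fin.insertNth (α := fun _ => α) i x f) = (List.ofFn f).insertIdx i x := by
  induction n with
  | zero =>
    obtain rfl : i = 0 := Fin.fin_one_eq_zero i
    simp
  | succ n ih =>
    cases i using Fin.cases with
    | zero => simp
    | succ i =>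
      rw [List.ofFn_succ, List.ofFn_succ (f := f), Fin.val_succ, List.insertIdx_succ_cons,
        ← ih]
      congr 1
      refine congrArg List.ofFn ?_
      rw [Fin.eq_insertNth_iff (α := fun _ => α)]
      refine ⟨by simp, ?_⟩
      ext j
      simp [Fin.removeNth, ← Fin.succ_succAbove_succ]

/-- Insertion of the new largest value at position `i` of a permutation. -/
def insertLast {n : ℕ} (i : Fin (n + 1)) (w : Equiv.Perm (Fin n)) : Equiv.Perm (Fin (n + 1)) :=
  (finSuccEquiv' i).trans (w.optionCongr.trans (finSuccEquiv' (Fin.last n)).symm)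

theorem insertLast_self {n : ℕ} (i : Fin (n + 1)) (w : Equiv.Perm (Fin n)) :
    insertLast i w i = Fin.last n := by
  simp [insertLast]

theorem insertLast_succAbove {n : ℕ} (i : Fin (n + 1)) (w : Equiv.Perm (Fin n)) (j : Fin n) :
    insertLast i w (i.succAbove j) = (w j).castSucc := by
  simp [insertLast]

theorem coe_insertLast {n : ℕ} (i : Fin (n + 1)) (w : Equiv.Perm (Fin n)) :
    ⇑(insertLast i w) =
      Fin.insertNth (α := fun _ => Fin (n + 1)) i (Fin.last n) (Fin.castSucc ∘ w) := by
  rw [Fin.eq_insertNth_iff]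
  exact ⟨insertLast_self i w, funext fun j => insertLast_succAbove i w j⟩

theorem insertLast_bijective (n : ℕ) :
    Function.Bijective fun p : Fin (n + 1) × Equiv.Perm (Fin n) => insertLast p.1 p.2 := by
  rw [Fintype.bijective_iff_injective_and_card]
  constructor
  · rintro ⟨i, w⟩ ⟨j, v⟩ h
    simp only at h
    obtain rfl : i = j := (insertLast i w).injective <| by
      rw [insertLast_self, h, insertLast_self]
    refine Prod.ext rfl (Equiv.ext fun k => Fin.castSucc_injective n ?_)
    rw [← insertLast_succAbove i, h, insertLast_succAbove]
  · simp [Fintype.card_perm, Nat.factorial_succ]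

theorem altLength_insertLast {n : ℕ} (i : Fin (n + 1)) (w : Equiv.Perm (Fin n)) :
    altLength (insertLast i w) =
      upDownRuns (((List.ofFn w).map Fin.castSucc).insertIdx i (Fin.last n)) := by
  rw [altLength_eq_upDownRuns, coe_insertLast, ofFn_insertNth_eq_insertIdx, List.map_ofFn]

theorem sum_altLength_insertLast {R : Type*} [CommRing R] {n : ℕ} (w : Equiv.Perm (Fin n))
    (g : ℕ → R) :
    ∑ i, g (altLength (insertLast i w)) =
      altLength w * g (altLength w) + g (altLength w + 1) +
        (n - altLength w) * g (altLength w + 2) := by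
  have h := sum_upDownRuns_insertIdx ((List.ofFn w).map Fin.castSucc) (Fin.last n)
    (by simp [Fin.castSucc_lt_last]) g
  rw [upDownRuns_map Fin.strictMono_castSucc, ← altLength_eq_upDownRuns, List.length_map,
    List.length_ofFn] at h
  simp only [altLength_insertLast]
  rw [← h, Finset.sum_range]

/-- The weight `g` is arbitrary because both `altPoly` and `altPolyHom` take their recurrence from
here. -/
theorem sum_perm_succ_altLength {R : Type*} [CommRing R] (n : ℕ) (g : ℕ → R) :
    ∑ v : Equiv.Perm (Fin (n + 1)), g (altLength v) =
      ∑ w : Equiv.Perm (Fin n), (altLength w * g (altLength w) + g (altLength w + 1) +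
        (n - altLength w) * g (altLength w + 2)) := by
  rw [← (insertLast_bijective n).sum_comp, Fintype.sum_prod_type_right]
  simp only [sum_altLength_insertLast]

theorem altLength_le {n : ℕ} (w : Equiv.Perm (Fin n)) : altLength w ≤ n := by
  rw [altLength_eq_upDownRuns]
  simpa using upDownRuns_le_length (List.ofFn w)

theorem altLength_eq_iff_isAlternating {n : ℕ} (w : Equiv.Perm (Fin n)) :
    altLength w = n ↔ IsAlternating w := by
  constructor
  · intro h
    obtain ⟨p, hp, hw⟩ := (altLength_isGreatest w).1
    revert p
    rw [h]
    intro p hp hw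
    have : p = id := by
      have := Subsingleton.elim (hp.orderIsoOfSurjective p
        (Finite.surjective_of_injective hp.injective)) (OrderIso.refl _)
      ext i
      exact congrArg (fun e => ((e i : Fin n) : ℕ)) this
    simpa [this] using hw
  · exact fun h => le_antisymm (altLength_le w)
      ((altLength_isGreatest w).2 ⟨id, strictMono_id, h⟩)

/-! ### Recurrence and divisibility -/

theorem altPoly_eq_sum (n : ℕ) : altPoly n = ∑ w : Equiv.Perm (Fin n), X ^ altLength w := by
  rw [altPoly, ← Finset.sum_fiberwise_of_maps_to (s := Finset.univ) (t := Finset.range (n + 1))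
    (g := altLength) (fun w _ => Finset.mem_range.2 (Nat.lt_succ_of_le (altLength_le w)))]
  refine Finset.sum_congr rfl fun k _ => ?_
  rw [Finset.sum_congr rfl fun w hw => by rw [(Finset.mem_filter.1 hw).2], Finset.sum_const,
    altCount]
  simp

theorem altPoly_succ (n : ℕ) :
    altPoly (n + 1) = X * derivative (altPoly n) + X * altPoly n +
      X ^ 2 * ((n : ℤ[X]) * altPoly n - X * derivative (altPoly n)) := by
  have h : X * derivative (altPoly n) =
      ∑ w : Equiv.Perm (Fin n), (altLength w : ℤ[X]) * X ^ altLength w := by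
    rw [altPoly_eq_sum, derivative_sum, Finset.mul_sum]
    refine Finset.sum_congr rfl fun w _ => ?_
    rw [derivative_X_pow]
    cases altLength w with
    | zero => simp
    | succ k => simp; ring
  rw [h, altPoly_eq_sum, altPoly_eq_sum, sum_perm_succ_altLength n fun k => (X : ℤ[X]) ^ k]
  simp only [Finset.mul_sum, ← Finset.sum_add_distrib, ← Finset.sum_sub_distrib]
  exact Finset.sum_congr rfl fun w _ => by ring

theorem altPoly_succ_of_dvd {n m : ℕ} {U : ℤ[X]} (h : altPoly n = (1 + X) ^ m * U) :
    altPoly (n + 1) = (1 + X) ^ m *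
      (X * ((1 - X ^ 2) * derivative U +
        ((m : ℤ[X]) + 1 + ((n : ℤ[X]) - (m : ℤ[X])) * X) * U)) := by
  -- The factor 1 + X, available from 1 - X² in the recurrence, avoids the exponent m - 1.
  have h' : (1 + X) * derivative (altPoly n) =
      (1 + X) ^ m * ((m : ℤ[X]) * U + (1 + X) * derivative U) := by
    rw [h, derivative_mul, derivative_pow]
    cases m with
    | zero => simp
    | succ m => simp; ring
  have h'' : altPoly (n + 1) = X * (1 - X) * ((1 + X) * derivative (altPoly n)) +
      (X + (n : ℤ[X]) * X ^ 2) * altPoly n := by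
    rw [altPoly_succ]; ring
  rw [h'', h', h]
  ring

theorem one_add_X_pow_dvd_altPoly_even_and_odd (m : ℕ) :
    (1 + X : ℤ[X]) ^ m ∣ altPoly (2 * m) ∧ (1 + X : ℤ[X]) ^ m ∣ altPoly (2 * m + 1) := by
  induction m with
  | zero => simp
  | succ m ih =>
    have h : (1 + X : ℤ[X]) ^ (m + 1) ∣ altPoly (2 * (m + 1)) := by
      obtain ⟨U, hU⟩ := ih.2
      -- From index 2m + 1 the coefficient of U is (m + 1)(1 + X), so 1 + X splits off both terms.
      refine ⟨X * ((1 - X) * derivative U + (m + 1 : ℤ[X]) * U), ?_⟩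
      rw [show 2 * (m + 1) = 2 * m + 1 + 1 by ring, altPoly_succ_of_dvd hU]
      push_cast
      ring
    refine ⟨h, ?_⟩
    obtain ⟨U, hU⟩ := h
    exact ⟨_, altPoly_succ_of_dvd hU⟩

theorem one_add_X_pow_dvd_altPoly (n : ℕ) : (1 + X : ℤ[X]) ^ (n / 2) ∣ altPoly n := by
  obtain ⟨m, rfl | rfl⟩ := Nat.even_or_odd' n
  · rw [Nat.mul_div_cancel_left m two_pos]
    exact (one_add_X_pow_dvd_altPoly_even_and_odd m).1
  · rw [show (2 * m + 1) / 2 = m by omega]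
    exact (one_add_X_pow_dvd_altPoly_even_and_odd m).2

/-- At -1 the derivative term vanishes and m + 1 + mX equals 1; the outer X gives the sign. -/
theorem eval_neg_one_quotient_odd {m : ℕ} {U V : ℤ[X]}
    (hU : altPoly (2 * m) = (1 + X) ^ m * U) (hV : altPoly (2 * m + 1) = (1 + X) ^ m * V) :
    V.eval (-1) = -U.eval (-1) := by
  have hX : (1 + X : ℤ[X]) ≠ 0 := by
    rw [add_comm]
    exact X_add_C_ne_zero 1
  have h := mul_left_cancel₀ (pow_ne_zero m hX) (hV.symm.trans (altPoly_succ_of_dvd hU))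
  rw [h]
  simp
  ring

/-! ### Derivative polynomials of the tangent -/

/-- The derivative polynomials of `c * tan (c * x)`, as polynomials in `c * tan (c * x)`. -/
noncomputable def tanPoly (c : ℤ) : ℕ → ℤ[X]
  | 0 => X
  | n + 1 => (C (c ^ 2) + X ^ 2) * derivative (tanPoly c n)

theorem tanPoly_comp_neg (c : ℤ) (n : ℕ) :
    (tanPoly c n).comp (-X) = (-1) ^ (n + 1) * tanPoly c n := by
  induction n with
  | zero => simp [tanPoly]
  | succ n ih =>
    have h := congrArg derivative ih
    rw [derivative_comp] at h
    have h1 : derivative ((-1 : ℤ[X]) ^ (n + 1) * tanPoly c n) =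
        (-1) ^ (n + 1) * derivative (tanPoly c n) := by
      rw [show ((-1 : ℤ[X]) ^ (n + 1)) = C ((-1) ^ (n + 1)) by simp, derivative_C_mul]
    rw [h1, derivative_neg, derivative_X] at h
    have h2 : (derivative (tanPoly c n)).comp (-X) =
        (-1) ^ (n + 1 + 1) * derivative (tanPoly c n) := by
      linear_combination -h
    rw [tanPoly, mul_comp, h2]
    simp
    ring

/-- This is 2 tan 2x = 2 f(2x) with f = tan, differentiated n times. -/
theorem tanPoly_two_comp (n : ℕ) :
    (tanPoly 2 n).comp (2 * X) = 2 ^ (n + 1) * tanPoly 1 n := by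
  induction n with
  | zero => simp [tanPoly]
  | succ n ih =>
    have h := congrArg derivative ih
    rw [derivative_comp] at h
    have h1 : derivative ((2 : ℤ[X]) ^ (n + 1) * tanPoly 1 n) =
        2 ^ (n + 1) * derivative (tanPoly 1 n) := by
      rw [show ((2 : ℤ[X]) ^ (n + 1)) = C (2 ^ (n + 1)) by simp, derivative_C_mul]
    have h2 : derivative (2 * X : ℤ[X]) = 2 := by
      rw [show (2 : ℤ[X]) = C 2 by simp, derivative_C_mul]; simp
    rw [h1, h2] at h
    rw [tanPoly, tanPoly, mul_comp]
    simp
    linear_combination (2 + 2 * X ^ 2) * h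

/-- The addition formula `2 tan 2x = tan (x + π/4) + tan (x - π/4)`, differentiated `n` times. -/
theorem aeval_tanPoly_two_sub_inv (n : ℕ) {u : ℝ} (hu : 0 < u) :
    aeval (u - u⁻¹) (tanPoly 2 n) = aeval u (tanPoly 1 n) + aeval (-u⁻¹) (tanPoly 1 n) := by
  induction n generalizing u with
  | zero => simp [tanPoly]; ring
  | succ n ih =>
    have hu' := hu.ne'
    have hi : HasDerivAt (fun x : ℝ => -x⁻¹) (u⁻¹ ^ 2) u := by
      rw [inv_pow, ← neg_neg (u ^ 2)⁻¹]
      exact (hasDerivAt_inv hu').fun_neg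
    have h1 : HasDerivAt (fun x : ℝ => aeval (x - x⁻¹) (tanPoly 2 n))
        (aeval (u - u⁻¹) (derivative (tanPoly 2 n)) * (1 + u⁻¹ ^ 2)) u := by
      have := ((tanPoly 2 n).hasDerivAt_aeval (u + -u⁻¹)).comp u ((hasDerivAt_id u).add hi)
      simpa [Function.comp_def, sub_eq_add_neg] using this
    have h2 : HasDerivAt (fun x : ℝ => aeval x (tanPoly 1 n) + aeval (-x⁻¹) (tanPoly 1 n))
        (aeval u (derivative (tanPoly 1 n)) +
          aeval (-u⁻¹) (derivative (tanPoly 1 n)) * u⁻¹ ^ 2) u :=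
      ((tanPoly 1 n).hasDerivAt_aeval u).add
        (HasDerivAt.comp (h := fun x : ℝ => -x⁻¹) u ((tanPoly 1 n).hasDerivAt_aeval (-u⁻¹)) hi)
    have h := (h1.congr_of_eventuallyEq
      ((eventually_gt_nhds hu).mono fun x hx => (ih hx).symm)).unique h2
    simp only [tanPoly, map_mul, map_add, map_pow, aeval_X, aeval_C]
    simp only [algebraMap_int_eq, eq_intCast]
    push_cast
    have hinv : u * u⁻¹ = 1 := mul_inv_cancel₀ hu'
    generalize u⁻¹ = v at *
    generalize aeval (u - v) (derivative (tanPoly 2 n)) = A at *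
    generalize aeval u (derivative (tanPoly 1 n)) = B at *
    generalize aeval (-v) (derivative (tanPoly 1 n)) = D at *
    -- With u = tan (x + π/4), d/dx is (1 + u²) d/du, and (1 + u²)(1 + u⁻²) = 4 + (u - u⁻¹)².
    linear_combination (1 + u ^ 2) * h + (D * (u * v + 1) - 2 * A - A * (u * v + 1)) * hinv

/-- The addition formula at u = 1, that is x = 0; for odd n the values at 1 and -1 agree by parity.
-/
theorem tanPoly_eval_one_of_odd {n : ℕ} (hn : Odd n) :
    (tanPoly 1 n).eval 1 = 2 ^ n * (tanPoly 1 n).eval 0 := by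
  have h1 := aeval_tanPoly_two_sub_inv n one_pos
  have h2 := congrArg (eval 1) (tanPoly_comp_neg 1 n)
  have h3 := congrArg (eval 0) (tanPoly_two_comp n)
  have h1' : (tanPoly 2 n).eval 0 = (tanPoly 1 n).eval 1 + (tanPoly 1 n).eval (-1) := by
    have e : ∀ (p : ℤ[X]) (z : ℤ), aeval (z : ℝ) p = ((p.eval z : ℤ) : ℝ) := fun p z => by
      simpa using aeval_algebraMap_apply ℝ z p
    have e0 := e (tanPoly 2 n) 0
    have e1 := e (tanPoly 1 n) 1
    have e2 := e (tanPoly 1 n) (-1)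
    push_cast at e0 e1 e2
    rw [inv_one, sub_self, e0, e1, e2] at h1
    exact_mod_cast h1
  simp [eval_comp, hn.add_one.neg_one_pow] at h2 h3
  have : 2 * (tanPoly 1 n).eval 1 = 2 * (2 ^ n * (tanPoly 1 n).eval 0) := by
    rw [← mul_assoc, ← pow_succ', ← h3, h1', h2]; ring
  linarith

/-! ### From T_n to the tangent polynomials -/

/-- The polynomial `T_n`, made homogeneous and evaluated at `(s ^ 2 + 1, s ^ 2 - 1)`. -/
noncomputable def altPolyHom (n : ℕ) : ℤ[X] :=
  ∑ w : Equiv.Perm (Fin n), (X ^ 2 + 1) ^ altLength w * (X ^ 2 - 1) ^ (n - altLength w)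

theorem altPolyHom_succ (n : ℕ) :
    altPolyHom (n + 1) =
      (X ^ 2 + 1) * ((1 - n : ℤ[X]) * altPolyHom n + X * derivative (altPolyHom n)) := by
  rw [altPolyHom, sum_perm_succ_altLength n fun k =>
    (X ^ 2 + 1 : ℤ[X]) ^ k * (X ^ 2 - 1) ^ (n + 1 - k), altPolyHom, derivative_sum,
    Finset.mul_sum, Finset.mul_sum, ← Finset.sum_add_distrib, Finset.mul_sum]
  refine Finset.sum_congr rfl fun w _ => ?_
  obtain ⟨r, hr⟩ := Nat.exists_eq_add_of_le (altLength_le w)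
  generalize altLength w = k at hr
  subst hr
  -- The truncated exponent r - 1 is harmless: its coefficient is r.
  rw [show k + r + 1 - k = r + 1 by omega, show k + r + 1 - (k + 1) = r by omega,
    show k + r + 1 - (k + 2) = r - 1 by omega, show k + r - k = r by omega]
  rw [derivative_mul, derivative_pow, derivative_pow]
  cases k <;> cases r <;> simp <;> ring

theorem X_mul_altPolyHom (n : ℕ) : X * altPolyHom n = X ^ n * tanPoly 1 n := by
  induction n with
  | zero =>
    have h : ∀ w : Equiv.Perm (Fin 0), altLength w = 0 := fun w => Nat.le_zero.1 (altLength_le w)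
    simp [altPolyHom, tanPoly, h]
  | succ n ih =>
    have h := congrArg derivative ih
    rw [derivative_mul, derivative_mul, derivative_X, derivative_X_pow] at h
    have h' : X * (C (n : ℤ) * X ^ (n - 1)) = C (n : ℤ) * (X ^ n : ℤ[X]) := by
      cases n with
      | zero => simp
      | succ n => simp; ring
    rw [altPolyHom_succ, tanPoly]
    simp at h h' ⊢
    linear_combination X * (X ^ 2 + 1) * h + (X ^ 2 + 1) * tanPoly 1 n * h' -
      (X ^ 2 + 1) * n * ih

theorem altPolyHom_eval_one (n : ℕ) : (altPolyHom n).eval 1 = 2 ^ n * eulerNumber n := by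
  rw [altPolyHom, eval_finsetSum, eulerNumber, Finset.card_filter]
  push_cast
  rw [Finset.mul_sum]
  refine Finset.sum_congr rfl fun w _ => ?_
  simp only [← altLength_eq_iff_isAlternating]
  split_ifs with h
  · simp [h]
  · have : n - altLength w ≠ 0 := by
      have := altLength_le w
      omega
    simp [this]

theorem tanPoly_eval_zero_of_odd {n : ℕ} (hn : Odd n) :
    (tanPoly 1 n).eval 0 = eulerNumber n := by
  have h := congrArg (eval 1) (X_mul_altPolyHom n)
  simp only [eval_mul, eval_X, eval_pow, one_pow, one_mul, altPolyHom_eval_one,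
    tanPoly_eval_one_of_odd hn] at h
  exact (mul_left_cancel₀ (by positivity) h).symm

theorem aeval_altPolyHom (n : ℕ) {s : ℝ} (hs : s ^ 2 - 1 ≠ 0) :
    aeval s (altPolyHom n) =
      (s ^ 2 - 1) ^ n * aeval ((s ^ 2 + 1) / (s ^ 2 - 1)) (altPoly n) := by
  rw [altPolyHom, altPoly_eq_sum, map_sum, map_sum, Finset.mul_sum]
  refine Finset.sum_congr rfl fun w _ => ?_
  simp only [map_mul, map_pow, map_add, map_sub, aeval_X, map_one, div_pow]
  rw [pow_sub₀ _ hs (altLength_le w)]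
  field_simp

theorem two_pow_mul_eval_neg_one_quotient_odd {m : ℕ} {U : ℤ[X]}
    (hU : altPoly (2 * m + 1) = (1 + X) ^ m * U) :
    2 ^ m * U.eval (-1) = (-1) ^ (m + 1) * eulerNumber (2 * m + 1) := by
  -- Since 1 + t = 2s²/(s² - 1), the factor (1 + t)^m supplies the s^(2m) needed to cancel s^(2m+1).
  have key : ∀ s : ℝ, s ≠ 0 → s ^ 2 - 1 ≠ 0 →
      (s ^ 2 - 1) ^ (m + 1) * 2 ^ m * aeval ((s ^ 2 + 1) / (s ^ 2 - 1)) U =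
        aeval s (tanPoly 1 (2 * m + 1)) := by
    intro s h0 h1
    have h := congrArg (aeval s) (X_mul_altPolyHom (2 * m + 1))
    simp only [map_mul, map_pow, aeval_X, aeval_altPolyHom _ h1, hU, map_add, map_one] at h
    have h2 : 1 + (s ^ 2 + 1) / (s ^ 2 - 1) = 2 * s ^ 2 / (s ^ 2 - 1) := by
      field_simp; ring
    rw [h2, div_pow] at h
    refine mul_left_cancel₀ (pow_ne_zero (2 * m + 1) h0) ?_
    rw [← h]
    field_simp
    ring
  have hf : ContinuousAt (fun s : ℝ =>
      (s ^ 2 - 1) ^ (m + 1) * 2 ^ m * aeval ((s ^ 2 + 1) / (s ^ 2 - 1)) U) 0 := by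
    refine ContinuousAt.mul (by fun_prop) ?_
    refine ContinuousAt.comp (g := fun x : ℝ => aeval x U) U.continuous_aeval.continuousAt ?_
    exact ContinuousAt.div (by fun_prop) (by fun_prop) (by norm_num)
  have hg : ContinuousAt (fun s : ℝ => aeval s (tanPoly 1 (2 * m + 1))) 0 :=
    (tanPoly 1 (2 * m + 1)).continuous_aeval.continuousAt
  have hne : ∀ᶠ s : ℝ in nhds 0, s ^ 2 - 1 ≠ 0 :=
    ContinuousAt.eventually_ne (g := fun s : ℝ => s ^ 2 - 1) (by fun_prop) (by norm_num)
  -- The cancellation required s ≠ 0; continuity extends `key` to s = 0, where t = -1.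
  have heq := tendsto_nhds_unique_of_eventuallyEq (hf.tendsto.mono_left nhdsWithin_le_nhds)
    (hg.tendsto.mono_left nhdsWithin_le_nhds) (l := nhdsWithin (0 : ℝ) {0}ᶜ) (by
      filter_upwards [self_mem_nhdsWithin, nhdsWithin_le_nhds hne] with s h0 h1
      exact key s h0 h1)
  have e : ∀ (p : ℤ[X]) (z : ℤ), aeval (z : ℝ) p = ((p.eval z : ℤ) : ℝ) := fun p z => by
    simpa using aeval_algebraMap_apply ℝ z p
  have e0 := e (tanPoly 1 (2 * m + 1)) 0
  have e1 := e U (-1)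
  push_cast at e0 e1
  rw [tanPoly_eval_zero_of_odd ⟨m, rfl⟩] at e0
  simp only [ne_eq, OfNat.ofNat_ne_zero, not_false_eq_true, zero_pow, zero_sub, zero_add,
    div_neg, div_one, e0, e1] at heq
  have : ((-1 : ℤ)) ^ (m + 1) * (2 ^ m * U.eval (-1)) = eulerNumber (2 * m + 1) := by
    have h : ((-1 : ℝ)) ^ (m + 1) * 2 ^ m * (U.eval (-1) : ℤ) = eulerNumber (2 * m + 1) := by
      simpa using heq
    rw [mul_assoc] at h
    exact_mod_cast h
  rw [← this, ← mul_assoc, ← mul_pow]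
  simp

/-! ### Parity of as(w) and the conclusion -/

theorem altPoly_eval_neg_one {n : ℕ} (hn : 2 ≤ n) : (altPoly n).eval (-1) = 0 := by
  obtain ⟨U, hU⟩ := one_add_X_pow_dvd_altPoly n
  have : n / 2 ≠ 0 := by omega
  simp [hU, this]

theorem card_even_eq_card_odd_altLength {n : ℕ} (hn : 2 ≤ n) :
    (Finset.univ.filter fun w : Equiv.Perm (Fin n) => Even (altLength w)).card =
      (Finset.univ.filter fun w : Equiv.Perm (Fin n) => Odd (altLength w)).card := by
  have h := altPoly_eval_neg_one hn
  rw [altPoly_eq_sum, eval_finsetSum,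
    ← Finset.sum_filter_add_sum_filter_not _ fun w => Even (altLength w)] at h
  have h1 : ∀ w ∈ Finset.univ.filter fun w : Equiv.Perm (Fin n) => Even (altLength w),
      eval (-1) (X ^ altLength w : ℤ[X]) = 1 := fun w hw => by
    simp [(Finset.mem_filter.1 hw).2.neg_one_pow]
  have h2 : ∀ w ∈ Finset.univ.filter fun w : Equiv.Perm (Fin n) => ¬Even (altLength w),
      eval (-1) (X ^ altLength w : ℤ[X]) = -1 := fun w hw => by
    simp [(Nat.not_even_iff_odd.1 (Finset.mem_filter.1 hw).2).neg_one_pow]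
  rw [Finset.sum_congr rfl h1, Finset.sum_congr rfl h2] at h
  simp only [Nat.not_even_iff_odd, Finset.sum_const, nsmul_eq_mul] at h
  linarith

theorem mainTheorem5 :
    (∀ n : ℕ, (1 + X : ℤ[X]) ^ (n / 2) ∣ altPoly n) ∧
    (∀ U : ℕ → ℤ[X], (∀ n : ℕ, altPoly n = (1 + X) ^ (n / 2) * U n) →
      ∀ n : ℕ,
        (((U (2 * n)).eval (-1) : ℤ) : ℚ) = (-1) ^ n * (eulerNumber (2 * n + 1) : ℚ) / 2 ^ n ∧
        -(((U (2 * n + 1)).eval (-1) : ℤ) : ℚ) =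
          (-1) ^ n * (eulerNumber (2 * n + 1) : ℚ) / 2 ^ n) ∧
    (∀ n : ℕ, 2 ≤ n →
      (altPoly n).eval (-1) = 0 ∧
      ((Finset.univ.filter fun w : Equiv.Perm (Fin n) => Even (altLength w)).card : ℚ) =
        (Nat.factorial n : ℚ) / 2 ∧
      ((Finset.univ.filter fun w : Equiv.Perm (Fin n) => Odd (altLength w)).card : ℚ) =
        (Nat.factorial n : ℚ) / 2) := by
  refine ⟨one_add_X_pow_dvd_altPoly, fun U hU n => ?_, fun n hn => ?_⟩
  · have h0 := hU (2 * n)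
    have h1 := hU (2 * n + 1)
    rw [Nat.mul_div_cancel_left n two_pos] at h0
    rw [show (2 * n + 1) / 2 = n by omega] at h1
    have h2 : (2 : ℚ) ^ n * ((U (2 * n + 1)).eval (-1) : ℤ) =
        (-1) ^ (n + 1) * (eulerNumber (2 * n + 1) : ℚ) := by
      exact_mod_cast two_pow_mul_eval_neg_one_quotient_odd h1
    have h3 : -(((U (2 * n + 1)).eval (-1) : ℤ) : ℚ) =
        (-1) ^ n * (eulerNumber (2 * n + 1) : ℚ) / 2 ^ n := by
      rw [eq_div_iff (by positivity)]
      linear_combination -h2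
    refine ⟨?_, h3⟩
    rw [← h3, eval_neg_one_quotient_odd h0 h1]
    simp
  · have h := card_even_eq_card_odd_altLength hn
    have h' := Finset.card_filter_add_card_filter_not
      (s := (Finset.univ : Finset (Equiv.Perm (Fin n)))) fun w => Even (altLength w)
    simp only [Nat.not_even_iff_odd, Finset.card_univ, Fintype.card_perm, Fintype.card_fin] at h'
    refine ⟨altPoly_eval_neg_one hn, ?_, ?_⟩
    · rw [← h', ← h]; push_cast; ring
    · rw [← h', h]; push_cast; ring
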